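/- For a topological space $Y$, let $\mathcal M_\tau(Y)$ be the set of $\tau$-additive Borel probability measures on $Y$, i.e. Borel probability measures $\mu$ with $\mu(\bigcup\mathcal U)=\sup_{U\in\mathcal U}\mu(U)$ for every non-empty upwards directed family $\mathcal U$ of open sets. Equip $\mathcal M_\tau(Y)$ with the weak topology, i.e. the coarsest topology for which $\nu\mapsto\int f\,d\nu$ is continuous for every bounded continuous $f:Y\to\mathbb R$. For $\mu\in\mathcal M_\tau(Y)$ and $\nu\in\mathcal M_\tau(Z)$ let $\mu\times\nu$ be the unique $\tau$-additive probability measure on the Borel $\sigma$-algebra of the topological space $Y\times Z$ such that $(\mu\times\nu)(A\times B)=\mu(A)\,\nu(B)$ for all open $A\subseteq Y$, $B\subseteq Z$. If a topological group $G$ acts (jointly) continuously on $X$ via $\pi:G\times X\to X$, the convolution of $\mu\in\mathcal M_\tau(G)$ and $\nu\in\mathcal M_\tau(X)$ is the measure $\mu*\nu\in\mathcal M_\tau(X)$ given by $(\mu*\nu)(E)=(\mu\times\nu)(\pi^{-1}[E])$ for Borel $E\subseteq X$. The convolution on $\mathcal M_\tau(G)$ is the case where $G$ acts on itself by left translation.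 **Corollary.** Let $G$ be a topological group acting continuously on a regular topological space $X$ (neither is assumed to be Hausdorff). Then for every $\mu\in\mathcal M_\tau(G)$ the map $\mathcal M_\tau(X)\to\mathcal M_\tau(X)$, $\nu\mapsto\mu*\nu$, is continuous for the weak topology. Moreover, $(\mathcal M_\tau(X),\mathcal M_\tau(G))$ is a (possibly non-compact) discrete dynamical system. That is: 1. $\mathcal M_\tau(G)$ with convolution is a semigroup whose neutral element is the Dirac measure $\delta_1$ at the identity $1\in G$; 2. this semigroup acts on $\mathcal M_\tau(X)$ by convolution: $(\mu_1*\mu_2)*\nu=\mu_1*(\mu_2*\nu)$ and $\delta_1*\nu=\nu$ for all $\mu_1,\mu_2\in\mathcal M_\tau(G)$ and $\nu\in\mathcal M_\tau(X)$; 3. the action map $\mathcal M_\tau(G)\times\mathcal M_\tau(X)\to\mathcal M_\tau(X)$, $(\mu,\nu)\mapsto\mu*\nu$, is continuous when $\mathcal M_\tau(G)$ carries the discrete topology and $\mathcal M_\tau(X)$ the weak topology. -/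

import Mathlib

open MeasureTheory Topology
open scoped ENNReal

/-- A measure `μ` on the Borel `σ`-algebra of `X` is `τ`-additive if `μ (⋃ 𝒰) = sup_{U ∈ 𝒰} μ U`
for every non-empty upwards directed family `𝒰` of open sets. -/
def IsTauAdditive {X : Type*} [TopologicalSpace X] (μ : @Measure X (borel X)) : Prop :=
  ∀ 𝒰 : Set (Set X), 𝒰.Nonempty → DirectedOn (· ⊆ ·) 𝒰 → (∀ U ∈ 𝒰, IsOpen U) →
    μ (⋃₀ 𝒰) = ⨆ U ∈ 𝒰, μ U

/-- The set of all `τ`-additive Borel probability measures on the topological space `X`. -/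
def TauMeasure (X : Type*) [TopologicalSpace X] : Type _ :=
  {μ : @ProbabilityMeasure X (borel X) //
    IsTauAdditive (@ProbabilityMeasure.toMeasure X (borel X) μ)}

namespace TauMeasure

variable {X Y : Type*} [TopologicalSpace X] [TopologicalSpace Y]

/-- The underlying Borel measure. -/
def toMeasure (μ : TauMeasure X) : @Measure X (borel X) :=
  @ProbabilityMeasure.toMeasure X (borel X) μ.1

/-- The weak topology: the coarsest one making `μ ↦ ∫ f dμ` continuous for every bounded
continuous `f`. It is Mathlib's topology on probability measures, restricted to the
`τ`-additive ones. -/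
noncomputable instance : TopologicalSpace (TauMeasure X) :=
  @instTopologicalSpaceSubtype _ _
    (@ProbabilityMeasure.instTopologicalSpace X (borel X) _
      (@OpensMeasurableSpace.mk X _ (borel X) le_rfl))

/-- A `τ`-additive Borel probability measure, from a measure and the two properties. -/
def mk (μ : @Measure X (borel X)) (hp : @IsProbabilityMeasure X (borel X) μ)
    (ht : IsTauAdditive μ) : TauMeasure X :=
  ⟨@Subtype.mk _ (fun μ : @Measure X (borel X) => @IsProbabilityMeasure X (borel X) μ) μ hp, ht⟩

theorem isProbabilityMeasure (μ : TauMeasure X) :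
    @IsProbabilityMeasure X (borel X) μ.toMeasure := μ.1.2

theorem isTauAdditive (μ : TauMeasure X) : IsTauAdditive μ.toMeasure := μ.2

theorem toMeasure_mk (μ : @Measure X (borel X)) (hp : @IsProbabilityMeasure X (borel X) μ)
    (ht : IsTauAdditive μ) : (mk μ hp ht).toMeasure = μ := rfl

theorem ext {μ ν : TauMeasure X} (h : μ.toMeasure = ν.toMeasure) : μ = ν :=
  Subtype.ext (Subtype.ext h)

/-- The push-forward of a `τ`-additive Borel probability measure under a continuous map. -/
noncomputable def map (f : X → Y) (hf : Continuous f) (μ : TauMeasure X) : TauMeasure Y :=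
  have hm : @Measurable X Y (borel X) (borel Y) f := hf.borel_measurable
  mk (@Measure.map X Y (borel X) (borel Y) f μ.toMeasure)
    (by
      let := borel X
      let := borel Y
      have := μ.isProbabilityMeasure
      exact Measure.isProbabilityMeasure_map hm.aemeasurable)
    (by
      let := borel X
      let := borel Y
      have : BorelSpace Y := ⟨rfl⟩
      intro 𝒰 hne hdir ho
      have h := μ.isTauAdditive ((fun U => f ⁻¹' U) '' 𝒰) (hne.image _)
        (by
          rintro _ ⟨U, hU, rfl⟩ _ ⟨V, hV, rfl⟩
          obtain ⟨W, hW, h1, h2⟩ := hdir U hU V hV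
          exact ⟨_, ⟨W, hW, rfl⟩, Set.preimage_mono h1, Set.preimage_mono h2⟩)
        (by
          rintro _ ⟨U, hU, rfl⟩
          exact (ho U hU).preimage hf)
      rw [iSup_image, Set.sUnion_image, ← Set.preimage_iUnion₂, ← Set.sUnion_eq_biUnion] at h
      rw [Measure.map_apply hm (isOpen_sUnion ho).measurableSet, h]
      exact biSup_congr fun U hU => (Measure.map_apply hm (ho U hU).measurableSet).symm)

/-- The Dirac measure at a point. -/
noncomputable def dirac (x : X) : TauMeasure X :=
  mk (@Measure.dirac X (borel X) x)
    (by
      let := borel X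
      exact Measure.dirac.isProbabilityMeasure)
    (by
      let := borel X
      have : BorelSpace X := ⟨rfl⟩
      intro 𝒰 hne hdir ho
      rw [Measure.dirac_apply' _ (isOpen_sUnion ho).measurableSet]
      have h : ∀ U ∈ 𝒰, Measure.dirac x U = U.indicator 1 x := fun U hU =>
        Measure.dirac_apply' _ (ho U hU).measurableSet
      rw [biSup_congr h]
      by_cases hx : x ∈ ⋃₀ 𝒰
      · obtain ⟨U, hU, hxU⟩ := hx
        apply le_antisymm
        · refine le_trans ?_ (le_iSup₂ U hU)
          rw [Set.indicator_of_mem hxU]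
          exact Set.indicator_le_self' (by simp) x
        · exact iSup₂_le fun V hV => Set.indicator_le_indicator_of_subset
            (Set.subset_sUnion_of_mem hV) (by simp) x
      · rw [Set.indicator_of_notMem hx]
        symm
        simp only [ENNReal.iSup_eq_zero]
        exact fun U hU => Set.indicator_of_notMem (fun h => hx ⟨U, hU, h⟩) _)

/-- `ρ` is a `τ`-additive product of `μ` and `ν`: a `τ`-additive probability measure on the Borel
`σ`-algebra of the product *topology* with `ρ (A × B) = μ A * ν B` for all open `A`, `B`. -/
def IsProduct (μ : TauMeasure X) (ν : TauMeasure Y) (ρ : TauMeasure (X × Y)) : Prop :=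
  ∀ (A : Set X) (B : Set Y), IsOpen A → IsOpen B →
    ρ.toMeasure (A ×ˢ B) = μ.toMeasure A * ν.toMeasure B

theorem isProduct_unique {μ : TauMeasure X} {ν : TauMeasure Y} {ρ₁ ρ₂ : TauMeasure (X × Y)}
    (h₁ : IsProduct μ ν ρ₁) (h₂ : IsProduct μ ν ρ₂) : ρ₁ = ρ₂ := by
  apply ext
  let m₀ : MeasurableSpace (X × Y) := borel (X × Y)
  have := ρ₁.isProbabilityMeasure
  have := ρ₂.isProbabilityMeasure
  let C : Set (Set (X × Y)) := {R | ∃ A B, IsOpen A ∧ IsOpen B ∧ R = A ×ˢ B}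
  have hCo : ∀ R ∈ C, IsOpen R := by
    rintro _ ⟨A, B, hA, hB, rfl⟩
    exact hA.prod hB
  have hC : IsPiSystem C := by
    rintro _ ⟨A, B, hA, hB, rfl⟩ _ ⟨A', B', hA', hB', rfl⟩ -
    exact ⟨A ∩ A', B ∩ B', hA.inter hA', hB.inter hB', Set.prod_inter_prod⟩
  have hle : MeasurableSpace.generateFrom C ≤ m₀ :=
    MeasurableSpace.generateFrom_le fun R hR => MeasurableSpace.measurableSet_generateFrom (hCo R hR)
  have hfin : ∀ s : Finset (Set (X × Y)), (s : Set (Set (X × Y))) ⊆ C →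
      ρ₁.toMeasure (⋃₀ (s : Set (Set (X × Y)))) = ρ₂.toMeasure (⋃₀ (s : Set (Set (X × Y)))) := by
    intro s hs
    refine ext_on_measurableSpace_of_generate_finite m₀ C ?_ hle rfl hC (by simp) ?_
    · rintro _ ⟨A, B, hA, hB, rfl⟩
      rw [h₁ A B hA hB, h₂ A B hA hB]
    · exact MeasurableSet.sUnion s.countable_toSet fun R hR =>
        MeasurableSpace.measurableSet_generateFrom (hs hR)
  have hopen : ∀ W : Set (X × Y), IsOpen W → ρ₁.toMeasure W = ρ₂.toMeasure W := by
    intro W hW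
    let 𝒰 : Set (Set (X × Y)) :=
      {U | ∃ s : Finset (Set (X × Y)), (s : Set (Set (X × Y))) ⊆ C ∧
        U = ⋃₀ (s : Set (Set (X × Y))) ∧ U ⊆ W}
    have hne : 𝒰.Nonempty := ⟨∅, ∅, by simp⟩
    have ho : ∀ U ∈ 𝒰, IsOpen U := by
      rintro _ ⟨s, hs, rfl, -⟩
      exact isOpen_sUnion fun R hR => hCo R (hs hR)
    have hdir : DirectedOn (· ⊆ ·) 𝒰 := by
      classical
      rintro _ ⟨s, hs, rfl, hsW⟩ _ ⟨t, ht, rfl, htW⟩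
      refine ⟨⋃₀ ((s ∪ t : Finset (Set (X × Y))) : Set (Set (X × Y))),
        ⟨s ∪ t, ?_, rfl, ?_⟩, ?_, ?_⟩
      · rw [Finset.coe_union]; exact Set.union_subset hs ht
      · rw [Finset.coe_union, Set.sUnion_union]; exact Set.union_subset hsW htW
      · rw [Finset.coe_union, Set.sUnion_union]; exact Set.subset_union_left
      · rw [Finset.coe_union, Set.sUnion_union]; exact Set.subset_union_right
    have hU : ⋃₀ 𝒰 = W := by
      apply Set.Subset.antisymm
      · rintro p ⟨U, ⟨-, -, -, hUW⟩, hp⟩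
        exact hUW hp
      · rintro ⟨x, y⟩ hp
        obtain ⟨A, B, hA, hB, hx, hy, hAB⟩ := isOpen_prod_iff.1 hW x y hp
        exact ⟨A ×ˢ B, ⟨{A ×ˢ B}, by simpa using ⟨A, B, hA, hB, rfl⟩, by simp, hAB⟩, hx, hy⟩
    rw [← hU, ρ₁.isTauAdditive 𝒰 hne hdir ho, ρ₂.isTauAdditive 𝒰 hne hdir ho]
    refine biSup_congr ?_
    rintro _ ⟨s, hs, rfl, -⟩
    exact hfin s hs
  exact ext_of_generate_finite {W | IsOpen W} rfl isPiSystem_isOpen hopen (by simp)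

/-- The `n`-th step-function approximation from above of a number in `[0, 1]`. -/
theorem step_bounds (n : ℕ) (hn : 0 < n) (t : ℝ≥0∞) (ht : t ≤ 1) :
    t ≤ ∑ k ∈ Finset.range n, (n : ℝ≥0∞)⁻¹ * (if (k : ℝ≥0∞) / n < t then 1 else 0) ∧
    ∑ k ∈ Finset.range n, (n : ℝ≥0∞)⁻¹ * (if (k : ℝ≥0∞) / n < t then 1 else 0)
      ≤ t + (n : ℝ≥0∞)⁻¹ := by
  lift t to NNReal using ne_top_of_le_ne_top ENNReal.one_ne_top ht
  have ht' : t ≤ 1 := by exact_mod_cast ht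
  have hn' : (0 : NNReal) < n := by exact_mod_cast hn
  have hiff : ∀ k : ℕ, ((k : ℝ≥0∞) / n < t) ↔ k < ⌈t * n⌉₊ := by
    intro k
    rw [Nat.lt_ceil, ← div_lt_iff₀ hn']
    have : (k : ℝ≥0∞) / n = ((k / n : NNReal) : ℝ≥0∞) := by
      rw [ENNReal.coe_div hn'.ne']; simp
    rw [this, ENNReal.coe_lt_coe]
  have hc : ⌈t * n⌉₊ ≤ n := Nat.ceil_le.2 (by nlinarith)
  have hsum : ∑ k ∈ Finset.range n, (n : ℝ≥0∞)⁻¹ * (if (k : ℝ≥0∞) / n < t then 1 else 0)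
      = (((n : NNReal)⁻¹ * (⌈t * n⌉₊ : NNReal) : NNReal) : ℝ≥0∞) := by
    simp only [hiff]
    rw [← Finset.mul_sum, Finset.sum_ite, Finset.sum_const_zero, add_zero, Finset.sum_const,
      nsmul_one]
    have : (Finset.range n).filter (· < ⌈t * n⌉₊) = Finset.range ⌈t * n⌉₊ := by
      ext k; simp; omega
    rw [this, Finset.card_range, ENNReal.coe_mul, ENNReal.coe_inv hn'.ne']
    simp
  rw [hsum]
  have hi : (n : ℝ≥0∞)⁻¹ = (((n : NNReal)⁻¹ : NNReal) : ℝ≥0∞) := by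
    rw [ENNReal.coe_inv hn'.ne']; simp
  rw [hi, ← ENNReal.coe_add, ENNReal.coe_le_coe, ENNReal.coe_le_coe]
  constructor
  · rw [inv_mul_eq_div, le_div_iff₀ hn']
    exact Nat.le_ceil _
  · rw [inv_mul_eq_div, div_le_iff₀ hn', add_mul, inv_mul_cancel₀ hn'.ne']
    exact (Nat.ceil_lt_add_one (by positivity)).le

/-- Integrals of directed families of lower semicontinuous functions commute with suprema. -/
theorem lintegral_iSup_of_lowerSemicontinuous (μ : TauMeasure X) {ι : Type*} [Nonempty ι]
    (f : ι → X → ℝ≥0∞) (hf : ∀ i, LowerSemicontinuous (f i)) (h1 : ∀ i x, f i x ≤ 1)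
    (hd : Directed (· ≤ ·) f) :
    @lintegral X (borel X) μ.toMeasure (fun x => ⨆ i, f i x) =
      ⨆ i, @lintegral X (borel X) μ.toMeasure (f i) := by
  let := borel X
  have : BorelSpace X := ⟨rfl⟩
  have := μ.isProbabilityMeasure
  apply le_antisymm _ (iSup_le fun i => lintegral_mono fun x => le_iSup (fun i => f i x) i)
  have hstep : ∀ g : X → ℝ≥0∞, LowerSemicontinuous g → ∀ n : ℕ,
      ∫⁻ x, ∑ k ∈ Finset.range n, (n : ℝ≥0∞)⁻¹ * (if (k : ℝ≥0∞) / n < g x then 1 else 0)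
        ∂μ.toMeasure =
      ∑ k ∈ Finset.range n, (n : ℝ≥0∞)⁻¹ * μ.toMeasure {x | (k : ℝ≥0∞) / n < g x} := by
    intro g hg n
    have hms : ∀ k : ℕ, MeasurableSet {x | (k : ℝ≥0∞) / n < g x} := fun k =>
      (hg.isOpen_preimage _).measurableSet
    have hm : ∀ k : ℕ, Measurable (fun x => if (k : ℝ≥0∞) / n < g x then (1 : ℝ≥0∞) else 0) :=
      fun k => Measurable.ite (hms k) measurable_const measurable_const
    rw [lintegral_finsetSum _ (fun k _ => (hm k).const_mul _)]
    refine Finset.sum_congr rfl fun k _ => ?_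
    rw [lintegral_const_mul _ (hm k)]
    congr 1
    rw [← lintegral_indicator_one (hms k)]
    exact lintegral_congr fun x => by simp [Set.indicator_apply]
  have hsup : LowerSemicontinuous fun x => ⨆ i, f i x := lowerSemicontinuous_iSup hf
  have key : ∀ n : ℕ, 0 < n → ∫⁻ x, ⨆ i, f i x ∂μ.toMeasure ≤
      (⨆ i, ∫⁻ x, f i x ∂μ.toMeasure) + (n : ℝ≥0∞)⁻¹ := by
    intro n hn
    calc ∫⁻ x, ⨆ i, f i x ∂μ.toMeasure
        ≤ ∑ k ∈ Finset.range n, (n : ℝ≥0∞)⁻¹ * μ.toMeasure {x | (k : ℝ≥0∞) / n < ⨆ i, f i x} := by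
          rw [← hstep _ hsup n]
          exact lintegral_mono fun x => (step_bounds n hn _ (iSup_le fun i => h1 i x)).1
      _ = ∑ k ∈ Finset.range n, ⨆ i, (n : ℝ≥0∞)⁻¹ * μ.toMeasure {x | (k : ℝ≥0∞) / n < f i x} := by
          refine Finset.sum_congr rfl fun k _ => ?_
          rw [← ENNReal.mul_iSup]
          congr 1
          have h := μ.isTauAdditive (Set.range fun i => {x | (k : ℝ≥0∞) / n < f i x})
            (Set.range_nonempty _)
            (by
              rintro _ ⟨i, rfl⟩ _ ⟨j, rfl⟩
              obtain ⟨l, hi, hj⟩ := hd i j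
              exact ⟨_, ⟨l, rfl⟩, fun x hx => lt_of_lt_of_le hx (hi x),
                fun x hx => lt_of_lt_of_le hx (hj x)⟩)
            (by
              rintro _ ⟨i, rfl⟩
              exact (hf i).isOpen_preimage _)
          rw [iSup_range, Set.sUnion_range] at h
          rw [← h]
          congr 1
          ext x
          simp [lt_iSup_iff]
      _ = ⨆ i, ∑ k ∈ Finset.range n, (n : ℝ≥0∞)⁻¹ * μ.toMeasure {x | (k : ℝ≥0∞) / n < f i x} := by
          refine ENNReal.finsetSum_iSup fun i j => ?_
          obtain ⟨l, hi, hj⟩ := hd i j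
          refine ⟨l, fun k => ⟨?_, ?_⟩⟩
          · exact mul_le_mul_right (measure_mono fun x hx => lt_of_lt_of_le hx (hi x)) _
          · exact mul_le_mul_right (measure_mono fun x hx => lt_of_lt_of_le hx (hj x)) _
      _ ≤ (⨆ i, ∫⁻ x, f i x ∂μ.toMeasure) + (n : ℝ≥0∞)⁻¹ := by
          refine iSup_le fun i => ?_
          rw [← hstep _ (hf i) n]
          calc _ ≤ ∫⁻ x, (f i x + (n : ℝ≥0∞)⁻¹) ∂μ.toMeasure :=
                lintegral_mono fun x => (step_bounds n hn _ (h1 i x)).2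
            _ = ∫⁻ x, f i x ∂μ.toMeasure + (n : ℝ≥0∞)⁻¹ := by
                rw [lintegral_add_right _ measurable_const]; simp
            _ ≤ _ := by gcongr; exact le_iSup (fun i => ∫⁻ x, f i x ∂μ.toMeasure) i
  have hlim : Filter.Tendsto
      (fun n : ℕ => (⨆ i, ∫⁻ x, f i x ∂μ.toMeasure) + (n : ℝ≥0∞)⁻¹) Filter.atTop
      (𝓝 ((⨆ i, ∫⁻ x, f i x ∂μ.toMeasure) + 0)) :=
    ENNReal.tendsto_inv_nat_nhds_zero.const_add _
  rw [add_zero] at hlim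
  exact ge_of_tendsto hlim ((Filter.eventually_gt_atTop 0).mono key)

theorem lowerSemicontinuous_section (ν : TauMeasure Y) {W : Set (X × Y)} (hW : IsOpen W) :
    LowerSemicontinuous fun x => ν.toMeasure (Prod.mk x ⁻¹' W) := by
  intro x c hc
  let 𝒰 : Set (Set Y) := {B | IsOpen B ∧ ∃ A ∈ 𝓝 x, A ×ˢ B ⊆ W}
  have hU : ⋃₀ 𝒰 = Prod.mk x ⁻¹' W := by
    apply Set.Subset.antisymm
    · rintro y ⟨B, ⟨-, A, hA, hAB⟩, hy⟩
      exact hAB ⟨mem_of_mem_nhds hA, hy⟩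
    · intro y hy
      obtain ⟨A, B, hA, hB, hx, hy, hAB⟩ := isOpen_prod_iff.1 hW x y hy
      exact ⟨B, ⟨hB, A, hA.mem_nhds hx, hAB⟩, hy⟩
  have h := ν.isTauAdditive 𝒰 ⟨∅, isOpen_empty, Set.univ, Filter.univ_mem, by simp⟩
    (by
      rintro B ⟨hB, A, hA, hAB⟩ B' ⟨hB', A', hA', hAB'⟩
      refine ⟨B ∪ B', ⟨hB.union hB', A ∩ A', Filter.inter_mem hA hA', ?_⟩,
        Set.subset_union_left, Set.subset_union_right⟩
      rintro ⟨a, b⟩ ⟨⟨ha, ha'⟩, hb | hb⟩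
      · exact hAB ⟨ha, hb⟩
      · exact hAB' ⟨ha', hb⟩)
    (fun B hB => hB.1)
  rw [hU] at h
  simp only [h, lt_iSup_iff] at hc
  obtain ⟨B, ⟨hB, A, hA, hAB⟩, hcB⟩ := hc
  refine Filter.mem_of_superset hA fun a ha => lt_of_lt_of_le hcB ?_
  let := borel Y
  exact measure_mono fun b hb => hAB ⟨ha, hb⟩

theorem measurable_section (ν : TauMeasure Y) {W : Set (X × Y)}
    (hW : @MeasurableSet _ (borel (X × Y)) W) :
    @Measurable X ℝ≥0∞ (borel X) _ fun x => ν.toMeasure (Prod.mk x ⁻¹' W) := by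
  let := borel X
  have : BorelSpace X := ⟨rfl⟩
  let := borel Y
  have := ν.isProbabilityMeasure
  have hmk : ∀ x : X, @Measurable Y (X × Y) _ (borel (X × Y)) (Prod.mk x) := fun x =>
    (Continuous.prodMk_right x).borel_measurable
  induction W, hW using MeasurableSpace.induction_on_inter
    (m := borel (X × Y)) (s := {W | IsOpen W}) rfl isPiSystem_isOpen with
  | empty => simp
  | basic W hW => exact (lowerSemicontinuous_section ν hW).measurable
  | compl W hW ih =>
    have : ∀ x, ν.toMeasure (Prod.mk x ⁻¹' Wᶜ) = 1 - ν.toMeasure (Prod.mk x ⁻¹' W) := fun x =>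
      prob_compl_eq_one_sub (hmk x hW)
    simp only [this]
    exact measurable_const.sub ih
  | iUnion F hd hF ih =>
    have : ∀ x, ν.toMeasure (Prod.mk x ⁻¹' ⋃ i, F i) = ∑' i, ν.toMeasure (Prod.mk x ⁻¹' F i) := by
      intro x
      rw [Set.preimage_iUnion]
      exact measure_iUnion (fun i j hij => (hd hij).preimage _) fun i => hmk x (hF i)
    simp only [this]
    exact Measurable.tsum ih

theorem exists_isProduct (μ : TauMeasure X) (ν : TauMeasure Y) :
    ∃ ρ : TauMeasure (X × Y), IsProduct μ ν ρ := by
  let mX := borel X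
  have : BorelSpace X := ⟨rfl⟩
  let mY := borel Y
  have : BorelSpace Y := ⟨rfl⟩
  have := μ.isProbabilityMeasure
  have := ν.isProbabilityMeasure
  let mP : MeasurableSpace (X × Y) := borel (X × Y)
  have hmk : ∀ x : X, @Measurable Y (X × Y) _ (borel (X × Y)) (Prod.mk x) := fun x =>
    (Continuous.prodMk_right x).borel_measurable
  have hO : ∀ W : Set (X × Y), IsOpen W → MeasurableSet[mP] W := fun W hW =>
    MeasurableSpace.measurableSet_generateFrom hW
  let ρ : @Measure (X × Y) mP := @Measure.ofMeasurable (X × Y) mP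
    (fun W _ => ∫⁻ x, ν.toMeasure (Prod.mk x ⁻¹' W) ∂μ.toMeasure) (by simp)
    (by
      intro F hF hd
      have : ∀ x, ν.toMeasure (Prod.mk x ⁻¹' ⋃ i, F i) =
          ∑' i, ν.toMeasure (Prod.mk x ⁻¹' F i) := by
        intro x
        rw [Set.preimage_iUnion]
        exact measure_iUnion (fun i j hij => (hd hij).preimage _) fun i => hmk x (hF i)
      simp only [this]
      exact lintegral_tsum fun i => (measurable_section ν (hF i)).aemeasurable)
  have hρ : ∀ W, MeasurableSet[mP] W →
      ρ W = ∫⁻ x, ν.toMeasure (Prod.mk x ⁻¹' W) ∂μ.toMeasure := fun W hW =>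
    Measure.ofMeasurable_apply W hW
  refine ⟨mk ρ ⟨?_⟩ ?_, ?_⟩
  · rw [hρ _ (hO _ isOpen_univ)]; simp
  · intro 𝒰 hne hdir ho
    rw [hρ _ (hO _ (isOpen_sUnion ho)), biSup_congr fun U hU => hρ U (hO U (ho U hU)),
      iSup_subtype']
    have : Nonempty 𝒰 := hne.to_subtype
    rw [← lintegral_iSup_of_lowerSemicontinuous μ
      (fun (U : 𝒰) x => ν.toMeasure (Prod.mk x ⁻¹' (U : Set (X × Y))))
      (fun U => lowerSemicontinuous_section ν (ho U U.2)) (fun U x => prob_le_one)]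
    · refine lintegral_congr fun x => ?_
      have h := ν.isTauAdditive ((fun U => Prod.mk x ⁻¹' U) '' 𝒰) (hne.image _)
        (by
          rintro _ ⟨U, hU, rfl⟩ _ ⟨V, hV, rfl⟩
          obtain ⟨W, hW, h1, h2⟩ := hdir U hU V hV
          exact ⟨_, ⟨W, hW, rfl⟩, Set.preimage_mono h1, Set.preimage_mono h2⟩)
        (by
          rintro _ ⟨U, hU, rfl⟩
          exact (ho U hU).preimage (Continuous.prodMk_right x))
      rw [iSup_image, Set.sUnion_image, ← Set.preimage_iUnion₂, ← Set.sUnion_eq_biUnion,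
        iSup_subtype'] at h
      exact h
    · intro U V
      obtain ⟨W, hW, h1, h2⟩ := hdir U U.2 V V.2
      exact ⟨⟨W, hW⟩, fun x => measure_mono (Set.preimage_mono h1),
        fun x => measure_mono (Set.preimage_mono h2)⟩
  · intro A B hA hB
    refine (hρ _ (hO _ (hA.prod hB))).trans ?_
    have : ∀ x, ν.toMeasure (Prod.mk x ⁻¹' A ×ˢ B) = A.indicator (fun _ => ν.toMeasure B) x := by
      classical
      intro x
      rw [Set.mk_preimage_prod_right_eq_if]
      by_cases hx : x ∈ A <;> simp [hx]
    simp only [this]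
    rw [lintegral_indicator_const hA.measurableSet, mul_comm]

/-- The `τ`-additive product measure `μ × ν`: the unique `τ`-additive probability measure on the
Borel `σ`-algebra of `X × Y` with value `μ A * ν B` on every open rectangle `A × B`. -/
noncomputable def prod (μ : TauMeasure X) (ν : TauMeasure Y) : TauMeasure (X × Y) :=
  (exists_isProduct μ ν).choose

theorem isProduct_prod (μ : TauMeasure X) (ν : TauMeasure Y) : IsProduct μ ν (μ.prod ν) :=
  (exists_isProduct μ ν).choose_spec

/-- The convolution `μ ∗ ν`, for `G` acting on `X`: the push-forward of the product measure `μ × ν`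
under the action map, that is, `(μ ∗ ν) E = (μ × ν) {(g, x) | g • x ∈ E}` for `E` Borel. For
`X = G` with the action by left translation it is the convolution of measures on `G`. -/
noncomputable def conv {G : Type*} [TopologicalSpace G] [SMul G X] [ContinuousSMul G X]
    (μ : TauMeasure G) (ν : TauMeasure X) : TauMeasure X :=
  (μ.prod ν).map (fun p : G × X => p.1 • p.2) continuous_smul

end TauMeasure

/-- `(Y, S)` is a discrete dynamical system (`Y` not necessarily compact): the set `S` with `mul`
and `one` is a semigroup with neutral element, it acts on the topological space `Y` by `act`, and
the action map `S × Y → Y` is (jointly) continuous when `S` carries the discrete topology `⊥`. -/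
structure IsDiscreteDynamicalSystem {S Y : Type*} [TopologicalSpace Y]
    (mul : S → S → S) (one : S) (act : S → Y → Y) : Prop where
  mul_assoc : ∀ a b c, mul (mul a b) c = mul a (mul b c)
  one_mul : ∀ a, mul one a = a
  mul_one : ∀ a, mul a one = a
  mul_act : ∀ a b y, act (mul a b) y = act a (act b y)
  one_act : ∀ y, act one y = y
  continuous_act : @Continuous (S × Y) Y (@instTopologicalSpaceProd S Y ⊥ _) _
    (fun p => act p.1 p.2)

/-! Everything reduces to Fubini for the `τ`-additive product. By uniqueness this product is the
iterated integral, and also the swap of the product in the other order, so `∫ f d(μ ∗ ν)` equals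
both `∫∫ f (g • x) dν dμ` and `∫∫ f (g • x) dμ dν` (`lint_conv`, `lint_conv_symm`).

Weak continuity follows from the second form: the inner integral `x ↦ ∫ f (g • x) dμ(g)` must again
be a bounded continuous test function. No compactness is available, and `τ`-additivity replaces it.
The measure of a section of an open set is lower semicontinuous in the section; step functions
extend this to integrals of lower semicontinuous functions, and applying it to both `F` and `1 - F`
gives continuity (`continuous_lint`).

The algebraic laws compare iterated integrals of an arbitrary Borel function, and joint continuity
over a discrete factor is continuity in the other variable. -/

open scoped NNReal BoundedContinuousFunction

namespace TauMeasure

/-! ### Integration against `τ`-additive measures -/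

variable {X Y : Type*} [TopologicalSpace X] [TopologicalSpace Y]

/-- The lower Lebesgue integral with respect to a `τ`-additive Borel probability measure. -/
noncomputable def lint (μ : TauMeasure X) (f : X → ℝ≥0∞) : ℝ≥0∞ :=
  @lintegral X (borel X) μ.toMeasure f

theorem lint_le_one (μ : TauMeasure X) {f : X → ℝ≥0∞} (hf : ∀ x, f x ≤ 1) : μ.lint f ≤ 1 := by
  let := borel X
  have := μ.isProbabilityMeasure
  exact (lintegral_mono hf).trans (by simp)

theorem lint_const_mul (μ : TauMeasure X) (c : ℝ≥0∞) {f : X → ℝ≥0∞}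
    (hf : @Measurable X ℝ≥0∞ (borel X) _ f) : μ.lint (fun x => c * f x) = c * μ.lint f :=
  @lintegral_const_mul X (borel X) μ.toMeasure c f hf

theorem lint_one_sub (μ : TauMeasure X) {f : X → ℝ≥0∞}
    (hf : @Measurable X ℝ≥0∞ (borel X) _ f) (h1 : ∀ x, f x ≤ 1) :
    μ.lint (fun x => 1 - f x) = 1 - μ.lint f := by
  let := borel X
  have := μ.isProbabilityMeasure
  unfold lint
  rw [lintegral_sub hf (ne_top_of_le_ne_top ENNReal.one_ne_top (lint_le_one μ h1))
    (Filter.Eventually.of_forall h1)]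
  simp

/-- Two `τ`-additive measures are equal if they give every Borel function the same integral. -/
theorem ext_of_lint {μ ν : TauMeasure X}
    (h : ∀ f, @Measurable X ℝ≥0∞ (borel X) _ f → μ.lint f = ν.lint f) : μ = ν := by
  let := borel X
  apply ext
  refine Measure.ext fun s hs => ?_
  rw [← lintegral_indicator_one hs, ← lintegral_indicator_one hs]
  exact h _ (measurable_one.indicator hs)

theorem lint_map (μ : TauMeasure X) {φ : X → Y} (hφ : Continuous φ) {f : Y → ℝ≥0∞}
    (hf : @Measurable Y ℝ≥0∞ (borel Y) _ f) : (μ.map φ hφ).lint f = μ.lint (fun x => f (φ x)) :=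
  @lintegral_map X Y (borel X) (borel Y) μ.toMeasure f φ hf hφ.borel_measurable

theorem lint_dirac (x : X) {f : X → ℝ≥0∞} (hf : @Measurable X ℝ≥0∞ (borel X) _ f) :
    (dirac x).lint f = f x :=
  @lintegral_dirac' X (borel X) x f hf

/-! ### Fubini for the `τ`-additive product -/

/-- Makes `x ↦ δ_x × ν` a kernel, so that the product can be written with `Measure.bind` and
integrals against it unfold. Measurability is tested on Borel sets, where it is
`measurable_section`. -/
theorem measurable_map_mk (ν : TauMeasure Y) :
    @Measurable X (@Measure (X × Y) (borel (X × Y))) (borel X) (@Measure.instMeasurableSpace _ _)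
      fun x => @Measure.map Y (X × Y) (borel Y) (borel (X × Y)) (Prod.mk x) ν.toMeasure := by
  let := borel X
  let := borel Y
  refine @Measure.measurable_of_measurable_coe _ _ (borel (X × Y)) _ _ fun W hW => ?_
  have : ∀ x : X, @Measure.map Y (X × Y) (borel Y) (borel (X × Y)) (Prod.mk x) ν.toMeasure W =
      ν.toMeasure (Prod.mk x ⁻¹' W) := fun x =>
    @Measure.map_apply Y (X × Y) _ (borel (X × Y)) _ _
      (Continuous.prodMk_right x).borel_measurable _ hW
  simp only [this]
  exact measurable_section ν hW

/-- The product measure, as an iterated integral. -/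
theorem prod_toMeasure (μ : TauMeasure X) (ν : TauMeasure Y) :
    (μ.prod ν).toMeasure = @Measure.bind X (X × Y) (borel X) (borel (X × Y)) μ.toMeasure
      fun x => @Measure.map Y (X × Y) (borel Y) (borel (X × Y)) (Prod.mk x) ν.toMeasure := by
  let mX := borel X
  have : BorelSpace X := ⟨rfl⟩
  let mY := borel Y
  have : BorelSpace Y := ⟨rfl⟩
  have := μ.isProbabilityMeasure
  have := ν.isProbabilityMeasure
  -- The Borel `σ`-algebra of the product topology may be strictly larger than the product
  -- `σ`-algebra, so it is passed explicitly.
  let mP : MeasurableSpace (X × Y) := borel (X × Y)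
  have hO : ∀ W : Set (X × Y), IsOpen W → MeasurableSet[mP] W := fun W hW =>
    MeasurableSpace.measurableSet_generateFrom hW
  set ρ : @Measure (X × Y) mP := @Measure.bind X (X × Y) (borel X) (borel (X × Y)) μ.toMeasure
      fun x => @Measure.map Y (X × Y) (borel Y) (borel (X × Y)) (Prod.mk x) ν.toMeasure with hρdef
  have hρ : ∀ W, MeasurableSet[mP] W →
      ρ W = ∫⁻ x, ν.toMeasure (Prod.mk x ⁻¹' W) ∂μ.toMeasure := by
    intro W hW
    rw [hρdef, @Measure.bind_apply _ _ _ mP _ _ _ hW (measurable_map_mk ν).aemeasurable]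
    exact lintegral_congr fun x => @Measure.map_apply Y (X × Y) _ mP _ _
      (Continuous.prodMk_right x).borel_measurable _ hW
  have hprob : @IsProbabilityMeasure _ mP ρ := ⟨by rw [hρ _ (hO _ isOpen_univ)]; simp⟩
  -- The supremum is exchanged twice: inside by `τ`-additivity of `ν` on sections, outside by that
  -- of `μ`, since section measures form a directed family of lower semicontinuous functions.
  have htau : IsTauAdditive ρ := by
    intro 𝒰 hne hdir ho
    rw [hρ _ (hO _ (isOpen_sUnion ho)), biSup_congr fun U hU => hρ U (hO U (ho U hU)),
      iSup_subtype']
    have : Nonempty 𝒰 := hne.to_subtype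
    rw [← lintegral_iSup_of_lowerSemicontinuous μ
      (fun (U : 𝒰) x => ν.toMeasure (Prod.mk x ⁻¹' (U : Set (X × Y))))
      (fun U => lowerSemicontinuous_section ν (ho U U.2)) (fun U x => prob_le_one)]
    · refine lintegral_congr fun x => ?_
      have h := ν.isTauAdditive ((fun U => Prod.mk x ⁻¹' U) '' 𝒰) (hne.image _)
        (by
          rintro _ ⟨U, hU, rfl⟩ _ ⟨V, hV, rfl⟩
          obtain ⟨W, hW, h1, h2⟩ := hdir U hU V hV
          exact ⟨_, ⟨W, hW, rfl⟩, Set.preimage_mono h1, Set.preimage_mono h2⟩)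
        (by
          rintro _ ⟨U, hU, rfl⟩
          exact (ho U hU).preimage (Continuous.prodMk_right x))
      rw [iSup_image, Set.sUnion_image, ← Set.preimage_iUnion₂, ← Set.sUnion_eq_biUnion,
        iSup_subtype'] at h
      exact h
    · intro U V
      obtain ⟨W, hW, h1, h2⟩ := hdir U U.2 V V.2
      exact ⟨⟨W, hW⟩, fun x => measure_mono (Set.preimage_mono h1),
        fun x => measure_mono (Set.preimage_mono h2)⟩
  have hprod : IsProduct μ ν (mk ρ hprob htau) := by
    intro A B hA hB
    refine (hρ _ (hO _ (hA.prod hB))).trans ?_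
    have : ∀ x, ν.toMeasure (Prod.mk x ⁻¹' A ×ˢ B) = A.indicator (fun _ => ν.toMeasure B) x := by
      classical
      intro x
      rw [Set.mk_preimage_prod_right_eq_if]
      by_cases hx : x ∈ A <;> simp [hx]
    simp only [this]
    rw [lintegral_indicator_const hA.measurableSet, mul_comm]
  rw [isProduct_unique (isProduct_prod μ ν) hprod]
  rfl

theorem lint_prod (μ : TauMeasure X) (ν : TauMeasure Y) {f : X × Y → ℝ≥0∞}
    (hf : @Measurable _ ℝ≥0∞ (borel (X × Y)) _ f) :
    (μ.prod ν).lint f = μ.lint fun x => ν.lint fun y => f (x, y) := by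
  let := borel X
  let := borel Y
  unfold lint
  rw [prod_toMeasure, @Measure.lintegral_bind _ _ _ (borel (X × Y)) _ _ _
    (measurable_map_mk ν).aemeasurable hf.aemeasurable]
  exact lintegral_congr fun x => @lintegral_map _ _ _ (borel (X × Y)) _ _ _ hf
    (Continuous.prodMk_right x).borel_measurable

theorem measurable_lint_section (ν : TauMeasure Y) {f : X × Y → ℝ≥0∞}
    (hf : @Measurable _ ℝ≥0∞ (borel (X × Y)) _ f) :
    @Measurable X ℝ≥0∞ (borel X) _ fun x => ν.lint fun y => f (x, y) := by
  let := borel X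
  let := borel Y
  have h := (@Measure.measurable_lintegral _ (borel (X × Y)) f hf).comp (measurable_map_mk (X := X) ν)
  convert h using 2 with x
  exact (@lintegral_map _ _ _ (borel (X × Y)) _ _ _ hf
    (Continuous.prodMk_right x).borel_measurable).symm

/-- The swapped measure has the right values on open rectangles, so uniqueness identifies it. This
yields the second order of integration for free. -/
theorem prod_swap (μ : TauMeasure X) (ν : TauMeasure Y) :
    (ν.prod μ).map Prod.swap continuous_swap = μ.prod ν := by
  refine isProduct_unique (fun A B hA hB => ?_) (isProduct_prod μ ν)
  let := borel (X × Y)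
  let := borel (Y × X)
  refine (Measure.map_apply continuous_swap.borel_measurable
    (MeasurableSpace.measurableSet_generateFrom (hA.prod hB))).trans ?_
  rw [Set.preimage_swap_prod, isProduct_prod ν μ B A hB hA, mul_comm]

theorem lint_prod_symm (μ : TauMeasure X) (ν : TauMeasure Y) {f : X × Y → ℝ≥0∞}
    (hf : @Measurable _ ℝ≥0∞ (borel (X × Y)) _ f) :
    (μ.prod ν).lint f = ν.lint fun y => μ.lint fun x => f (x, y) := by
  rw [← prod_swap, lint_map _ _ hf]
  exact lint_prod ν μ (@Measurable.comp _ _ _ (borel (Y × X)) (borel (X × Y)) _ _ _ hf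
    continuous_swap.borel_measurable)

/-! ### Continuity of integrals over sections -/

/-- Integrals over sections of a lower semicontinuous function depend lower semicontinuously on
the section. -/
theorem lowerSemicontinuous_lint (μ : TauMeasure Y) {F : X × Y → ℝ≥0∞}
    (hF : LowerSemicontinuous F) (h1 : ∀ p, F p ≤ 1) :
    LowerSemicontinuous fun x => μ.lint fun y => F (x, y) := by
  let := borel Y
  have : BorelSpace Y := ⟨rfl⟩
  -- Integrals of the step functions that approximate `F` from above within `1/n`. Each is a finite
  -- combination of section measures of the open sets `{F > k/n}`, hence lower semicontinuous in
  -- `x`.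
  let S : ℕ → X → ℝ≥0∞ := fun n x =>
    ∑ k ∈ Finset.range n, μ.toMeasure (Prod.mk x ⁻¹' {p | (k : ℝ≥0∞) / n < F p}) * (n : ℝ≥0∞)⁻¹
  have hS : ∀ n x, S n x = ∫⁻ y, ∑ k ∈ Finset.range n,
      (n : ℝ≥0∞)⁻¹ * (if (k : ℝ≥0∞) / n < F (x, y) then 1 else 0) ∂μ.toMeasure := by
    intro n x
    have hms : ∀ k : ℕ, MeasurableSet {y | (k : ℝ≥0∞) / n < F (x, y)} := fun k =>
      ((hF.isOpen_preimage _).preimage (Continuous.prodMk_right x)).measurableSet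
    have hm : ∀ k : ℕ, Measurable fun y => if (k : ℝ≥0∞) / n < F (x, y) then (1 : ℝ≥0∞) else 0 :=
      fun k => Measurable.ite (hms k) measurable_const measurable_const
    rw [lintegral_finsetSum _ (fun k _ => (hm k).const_mul _)]
    refine Finset.sum_congr rfl fun k _ => ?_
    rw [lintegral_const_mul _ (hm k), mul_comm]
    congr 1
    change μ.toMeasure {y | (k : ℝ≥0∞) / n < F (x, y)} = _
    rw [← lintegral_indicator_one (hms k)]
    exact lintegral_congr fun y => by simp [Set.indicator_apply]
  have hle : ∀ n, 0 < n → ∀ x, μ.lint (fun y => F (x, y)) ≤ S n x := by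
    intro n hn x
    rw [hS]
    exact lintegral_mono fun y => (step_bounds n hn _ (h1 _)).1
  have hge : ∀ n, 0 < n → ∀ x, S n x ≤ μ.lint (fun y => F (x, y)) + (n : ℝ≥0∞)⁻¹ := by
    intro n hn x
    have := μ.isProbabilityMeasure
    rw [hS]
    refine (lintegral_mono fun y => (step_bounds n hn _ (h1 (x, y))).2).trans_eq ?_
    rw [lintegral_add_right _ measurable_const]
    simp [lint]
  have hlsc : ∀ n, 0 < n → LowerSemicontinuous (S n) := by
    intro n hn
    have hni : (n : ℝ≥0∞)⁻¹ ≠ ∞ := by simp [hn.ne']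
    refine lowerSemicontinuous_sum fun k _ => ?_
    exact (ENNReal.continuous_mul_const hni).comp_lowerSemicontinuous
      (lowerSemicontinuous_section μ (hF.isOpen_preimage _)) fun a b hab => mul_le_mul' hab le_rfl
  intro x c hc
  have hlim : Filter.Tendsto (fun n : ℕ => c + (n : ℝ≥0∞)⁻¹) Filter.atTop (𝓝 (c + 0)) :=
    ENNReal.tendsto_inv_nat_nhds_zero.const_add _
  rw [add_zero] at hlim
  -- Choose `n` so that `c + 1/n` is still below the integral at `x`, hence below `S n x`. This
  -- persists nearby, and the error `1/n` then cancels.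
  obtain ⟨n, hcn, hn⟩ :=
    ((hlim.eventually (gt_mem_nhds hc)).and (Filter.eventually_gt_atTop 0)).exists
  filter_upwards [hlsc n hn x _ (hcn.trans_le (hle n hn x))] with y hy
  exact lt_of_add_lt_add_right (hy.trans_le (hge n hn y))

/-- Integrals over sections of a continuous function depend continuously on the section. -/
theorem continuous_lint (μ : TauMeasure Y) {F : X × Y → ℝ≥0∞} (hF : Continuous F)
    (h1 : ∀ p, F p ≤ 1) : Continuous fun x => μ.lint fun y => F (x, y) := by
  have hle : ∀ x, (μ.lint fun y => F (x, y)) ≤ 1 := fun x => μ.lint_le_one fun y => h1 _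
  have hsub : Continuous fun t : ℝ≥0∞ => 1 - t := ENNReal.continuous_sub_left ENNReal.one_ne_top
  have hm : ∀ x, @Measurable Y ℝ≥0∞ (borel Y) _ fun y => F (x, y) := by
    let := borel Y
    have : BorelSpace Y := ⟨rfl⟩
    exact fun x => (hF.comp (Continuous.prodMk_right x)).measurable
  rw [continuous_iff_lower_upperSemicontinuous]
  refine ⟨lowerSemicontinuous_lint μ hF.lowerSemicontinuous h1, ?_⟩
  -- Upper semicontinuity comes from `∫ F = 1 - ∫ (1 - F)`, where `1 - F` is again continuous with
  -- values in `[0, 1]`.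
  have h := hsub.comp_lowerSemicontinuous_antitone
    (lowerSemicontinuous_lint μ (hsub.comp hF).lowerSemicontinuous fun p => tsub_le_self)
    fun a b hab => tsub_le_tsub_left hab 1
  convert h using 2 with x
  simp only [Function.comp_apply]
  rw [lint_one_sub μ (hm x) fun y => h1 _,
    ENNReal.sub_sub_cancel ENNReal.one_ne_top (hle x)]

/-! ### The weak topology through integrals of nonnegative test functions -/

theorem continuous_lint_boundedContinuousFunction (f : X →ᵇ ℝ≥0) :
    Continuous fun ν : TauMeasure X => ν.lint fun x => f x := by
  let := borel X
  have : BorelSpace X := ⟨rfl⟩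
  exact (ProbabilityMeasure.continuous_lintegral_boundedContinuousFunction f).comp
    continuous_subtype_val

theorem continuous_iff_lint {φ : Y → TauMeasure X} :
    Continuous φ ↔ ∀ f : X →ᵇ ℝ≥0, Continuous fun y => (φ y).lint fun x => f x := by
  let := borel X
  have : BorelSpace X := ⟨rfl⟩
  exact continuous_induced_rng.trans
    ProbabilityMeasure.continuous_iff_forall_continuous_lintegral

/-! ### Convolution as an iterated integral, and its weak continuity -/

section Action

variable {G : Type*} [TopologicalSpace G] [SMul G X] [ContinuousSMul G X]

theorem measurable_comp_smul {f : X → ℝ≥0∞} (hf : @Measurable X ℝ≥0∞ (borel X) _ f) :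
    @Measurable (G × X) ℝ≥0∞ (borel (G × X)) _ fun p => f (p.1 • p.2) :=
  @Measurable.comp _ _ _ (borel (G × X)) (borel X) _ _ _ hf continuous_smul.borel_measurable

theorem lint_conv (μ : TauMeasure G) (ν : TauMeasure X) {f : X → ℝ≥0∞}
    (hf : @Measurable X ℝ≥0∞ (borel X) _ f) :
    (μ.conv ν).lint f = μ.lint fun g => ν.lint fun x => f (g • x) := by
  rw [conv, lint_map _ _ hf, lint_prod _ _ (measurable_comp_smul hf)]

theorem lint_conv_symm (μ : TauMeasure G) (ν : TauMeasure X) {f : X → ℝ≥0∞}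
    (hf : @Measurable X ℝ≥0∞ (borel X) _ f) :
    (μ.conv ν).lint f = ν.lint fun x => μ.lint fun g => f (g • x) := by
  rw [conv, lint_map _ _ hf, lint_prod_symm _ _ (measurable_comp_smul hf)]

/-- Convolution with a fixed `τ`-additive measure is weakly continuous. -/
theorem continuous_conv (μ : TauMeasure G) : Continuous fun ν : TauMeasure X => μ.conv ν := by
  rw [continuous_iff_lint]
  intro f
  -- Rescaling by `M` brings `f` into `[0, 1]`, as `continuous_lint` requires; the `+ 1` keeps `M`
  -- invertible when `f = 0`.
  obtain ⟨M, hM0, hM⟩ : ∃ M : ℝ≥0, 0 < M ∧ ∀ x, f x ≤ M :=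
    ⟨nndist f 0 + 1, by positivity, fun x => (BoundedContinuousFunction.NNReal.upper_bound f x).trans le_self_add⟩
  let u : X → ℝ≥0∞ := fun x => ((M⁻¹ * f x : ℝ≥0) : ℝ≥0∞)
  have hu : Continuous u :=
    ENNReal.continuous_coe.comp (continuous_const.mul f.continuous)
  have hum : @Measurable X ℝ≥0∞ (borel X) _ u := by
    let := borel X
    have : BorelSpace X := ⟨rfl⟩
    exact hu.measurable
  have hu1 : ∀ x, u x ≤ 1 := by
    intro x
    have : M⁻¹ * f x ≤ 1 := by
      rw [inv_mul_eq_div]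
      exact div_le_one_of_le₀ (hM x) (by positivity)
    exact ENNReal.coe_le_one_iff.2 this
  have hfu : (fun x => (f x : ℝ≥0∞)) = fun x => M * u x := by
    ext x
    simp only [u]
    rw [← ENNReal.coe_mul, mul_inv_cancel_left₀ hM0.ne']
  let v : X → ℝ≥0∞ := fun x => μ.lint fun g => u (g • x)
  have hv : Continuous v := continuous_lint μ (F := fun p : X × G => u (p.2 • p.1))
    (hu.comp (continuous_snd.smul continuous_fst)) fun p => hu1 _
  have hv1 : ∀ x, v x ≤ 1 := fun x => μ.lint_le_one fun g => hu1 _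
  have hvtop : ∀ x, v x ≠ ∞ := fun x => ne_top_of_le_ne_top ENNReal.one_ne_top (hv1 x)
  have h01 : ∀ x, ((v x).toNNReal : ℝ) ∈ Set.Icc (0 : ℝ) 1 := by
    refine fun x => ⟨NNReal.coe_nonneg _, NNReal.coe_le_one.2 ?_⟩
    simpa using ENNReal.toNNReal_mono ENNReal.one_ne_top (hv1 x)
  -- The averaged function `v`, recast as a test function: integrating `f` against `μ ∗ ν` is
  -- integrating `M * w` against `ν`.
  let w : X →ᵇ ℝ≥0 := BoundedContinuousFunction.mkOfBound
    ⟨fun x => (v x).toNNReal, ENNReal.continuousOn_toNNReal.comp_continuous hv hvtop⟩ 1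
    fun x y => Real.dist_le_of_mem_Icc_01 (h01 x) (h01 y)
  have hw : ∀ x, (w x : ℝ≥0∞) = v x := fun x => ENNReal.coe_toNNReal (hvtop x)
  have key : ∀ ν : TauMeasure X,
      (μ.conv ν).lint (fun x => (f x : ℝ≥0∞)) = M * ν.lint fun x => w x := by
    intro ν
    rw [hfu, lint_const_mul _ _ hum, lint_conv_symm _ _ hum]
    simp only [hw, v]
  simp only [key]
  exact (ENNReal.continuous_const_mul ENNReal.coe_ne_top).comp
    (continuous_lint_boundedContinuousFunction w)

end Action

/-! ### Associativity and neutral element -/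

section Monoid

variable {G : Type*} [Monoid G] [TopologicalSpace G]

/-- Both sides integrate `f (g • h • x)` over `ν`, then `μ₂`, then `μ₁`; the order never changes. -/
theorem conv_conv [ContinuousMul G] [MulAction G X] [ContinuousSMul G X]
    (μ₁ μ₂ : TauMeasure G) (ν : TauMeasure X) :
    (μ₁.conv μ₂).conv ν = μ₁.conv (μ₂.conv ν) := by
  refine ext_of_lint fun f hf => ?_
  rw [lint_conv _ _ hf, lint_conv _ _ hf,
    lint_conv _ _ (measurable_lint_section ν (measurable_comp_smul hf))]
  congr 1
  ext g
  have hg : @Measurable X ℝ≥0∞ (borel X) _ fun x => f (g • x) :=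
    @Measurable.comp _ _ _ (borel X) (borel X) _ _ _ hf (continuous_const_smul g).borel_measurable
  rw [lint_conv _ _ hg]
  simp only [smul_eq_mul, mul_smul]

theorem dirac_one_conv [MulAction G X] [ContinuousSMul G X] (ν : TauMeasure X) :
    (dirac (1 : G)).conv ν = ν := by
  refine ext_of_lint fun f hf => ?_
  rw [lint_conv _ _ hf, lint_dirac _ (measurable_lint_section ν (measurable_comp_smul hf))]
  simp only [one_smul]

theorem conv_dirac_one [ContinuousMul G] (μ : TauMeasure G) : μ.conv (dirac (1 : G)) = μ := by
  refine ext_of_lint fun f hf => ?_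
  -- The order with the Dirac integral outermost is used, so that it evaluates the inner integral at
  -- `1`.
  rw [lint_conv_symm _ _ hf]
  have h := measurable_lint_section (X := G) μ (f := fun p : G × G => f (p.2 • p.1))
    (@Measurable.comp _ _ _ (borel (G × G)) (borel G) _ _ _ hf
      (continuous_snd.smul continuous_fst).borel_measurable)
  rw [lint_dirac _ h]
  simp only [smul_eq_mul, mul_one]

end Monoid

end TauMeasure

theorem mainTheorem7 {G X : Type*} [Group G] [TopologicalSpace G] [IsTopologicalGroup G]
    [TopologicalSpace X] [RegularSpace X] [MulAction G X] [ContinuousSMul G X] :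
    (∀ μ : TauMeasure G, Continuous fun ν : TauMeasure X => TauMeasure.conv μ ν) ∧
    IsDiscreteDynamicalSystem
      (fun μ₁ μ₂ : TauMeasure G => TauMeasure.conv μ₁ μ₂) (TauMeasure.dirac (1 : G))
      (fun (μ : TauMeasure G) (ν : TauMeasure X) => TauMeasure.conv μ ν) := by
  -- The semigroup laws are the case `X = G` of the action laws, apart from right neutrality.
  refine ⟨TauMeasure.continuous_conv, TauMeasure.conv_conv, TauMeasure.dirac_one_conv,
    TauMeasure.conv_dirac_one, TauMeasure.conv_conv, TauMeasure.dirac_one_conv, ?_⟩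
  exact (@continuous_prod_of_discrete_left _ _ _ ⊥ _ _ (@DiscreteTopology.mk _ ⊥ rfl) _).2
    TauMeasure.continuous_conv
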